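/- Let $\lambda_1,\lambda_2\ge 0$ with $\lambda_1+\lambda_2>0$, let $N>0$, and put $N_i=iN$ for $i=0,1,2,\dots$. Let $(S_t)_{t\ge 0}$ be a right-continuous, time-homogeneous continuous-time Markov chain with two states, $1$ (normal) and $2$ (default), whose transition rates are $\lambda_1$ (from $1$ to $2$) and $\lambda_2$ (from $2$ to $1$), and which starts in the normal state: $S_0=1$ almost surely. Define the recorded and the economic default time by $$\tau_r=\inf\{N_i : i\ge 0,\ S_{N_i}=2\}\in[0,\infty],\qquad \tau_e=\sup\{t\le\tau_r : S_t\neq 2\}\in[0,\infty].$$ Then the transition matrix of the chain from time $s$ to time $t$ $(0\le s\le t)$ is $$P(s,t)=\begin{pmatrix}\frac{\lambda_1}{\lambda_1+\lambda_2}e^{-(\lambda_1+\lambda_2)(t-s)}+\frac{\lambda_2}{\lambda_1+\lambda_2} & -\frac{\lambda_1}{\lambda_1+\lambda_2}e^{-(\lambda_1+\lambda_2)(t-s)}+\frac{\lambda_1}{\lambda_1+\lambda_2}\\ -\frac{\lambda_2}{\lambda_1+\lambda_2}e^{-(\lambda_1+\lambda_2)(t-s)}+\frac{\lambda_2}{\lambda_1+\lambda_2}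 & \frac{\lambda_2}{\lambda_1+\lambda_2}e^{-(\lambda_1+\lambda_2)(t-s)}+\frac{\lambda_1}{\lambda_1+\lambda_2}\end{pmatrix},$$ and the following hold. (a) For every integer $i\ge 0$ and every $t\in[0,N]$, $$P(\tau_e\in(N_i,N_i+t])=\left(\frac{\lambda_1}{\lambda_1+\lambda_2}e^{-(\lambda_1+\lambda_2)N}+\frac{\lambda_2}{\lambda_1+\lambda_2}\right)^{i}\left(\frac{\lambda_1}{\lambda_1+\lambda_2}-\frac{\lambda_1}{\lambda_1+\lambda_2}e^{-(\lambda_1+\lambda_2)t}\right)e^{-\lambda_2(N-t)}.$$ (b) For every integer $i\ge 0$, $$P(\tau_r=N_{i+1})=\left(\frac{\lambda_1}{\lambda_1+\lambda_2}e^{-(\lambda_1+\lambda_2)N}+\frac{\lambda_2}{\lambda_1+\lambda_2}\right)^{i}\left(-\frac{\lambda_1}{\lambda_1+\lambda_2}e^{-(\lambda_1+\lambda_2)N}+\frac{\lambda_1}{\lambda_1+\lambda_2}\right).$$ (c) If $\lambda_1>0$, then for every $t\in[0,N]$, $$P(\tau_r-\tau_e>t)=\frac{e^{-\lambda_2 t}-e^{-(\lambda_1+\lambda_2)N}e^{\lambda_1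 t}}{1-e^{-(\lambda_1+\lambda_2)N}}.$$ -/

import Mathlib

open MeasureTheory Filter Topology
open scoped NNReal ENNReal

/-- `p` is a (stochastic) transition semigroup on the finite state space `E`, and its transition
rates (its derivative at time `0`) are the entries of the matrix `A`. -/
structure IsTransitionSemigroup {E : Type*} [Fintype E] [DecidableEq E]
    (A : Matrix E E ℝ) (p : ℝ≥0 → Matrix E E ℝ) : Prop where
  nonneg : ∀ t i j, 0 ≤ p t i j
  row_sum : ∀ t i, ∑ j, p t i j = 1
  zero : p 0 = 1
  add : ∀ s t, p (s + t) = p s * p t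
  rate : ∀ i j, Tendsto (fun h : ℝ≥0 => (p h i j - (1 : Matrix E E ℝ) i j) / (h : ℝ))
    (𝓝[>] 0) (𝓝 (A i j))

/-- The information generated by the process `S` up to time `s`. -/
@[reducible] def history {Ω E : Type*} (S : ℝ≥0 → Ω → E) (s : ℝ≥0) : MeasurableSpace Ω :=
  ⨆ u ∈ Set.Iic s, MeasurableSpace.comap (S u) ⊤

/-- `S` is a continuous-time Markov chain on the finite (discrete) state space `E` with transition
function `P(s, t) = p (t - s)`: almost all paths are right-continuous, and conditionally on
the history up to time `s` the state at time `s + h` is `j` with probability `p h (S s) j`. -/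
structure IsMarkovChain {Ω E : Type*} [MeasurableSpace Ω] [Fintype E] [DecidableEq E]
    (μ : Measure Ω) (p : ℝ≥0 → Matrix E E ℝ) (S : ℝ≥0 → Ω → E) : Prop where
  measurable : ∀ t j, MeasurableSet {ω | S t ω = j}
  right_continuous : ∀ᵐ ω ∂μ, ∀ t, ∀ᶠ u in 𝓝[>] t, S u ω = S t ω
  markov : ∀ (s h : ℝ≥0) (j : E),
    μ[Set.indicator {ω | S (s + h) ω = j} (fun _ => (1 : ℝ)) | history S s]
      =ᵐ[μ] fun ω => p h (S s ω) j

/-- The recorded default time: the first payment date `i * N` (with `i = 0, 1, 2, …`) at which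
the chain is in the default state `d`; it is `∞` if there is no such date. -/
noncomputable def recordedDefault {Ω E : Type*} (S : ℝ≥0 → Ω → E) (d : E) (N : ℝ≥0) (ω : Ω) :
    ℝ≥0∞ :=
  sInf {x | ∃ i : ℕ, x = ((i * N : ℝ≥0) : ℝ≥0∞) ∧ S (i * N) ω = d}

/-- The economic default time: the supremum of the times up to the recorded default time at which
the chain is not in the default state `d`. -/
noncomputable def economicDefault {Ω E : Type*} (S : ℝ≥0 → Ω → E) (d : E) (N : ℝ≥0) (ω : Ω) :
    ℝ≥0∞ :=
  sSup {x | ∃ t : ℝ≥0, x = (t : ℝ≥0∞) ∧ x ≤ recordedDefault S d N ω ∧ S t ω ≠ d}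

/-!
The proof separates the matrix computation, the probability of a path event, and a pathwise
description of the two default times.

For the transition matrix, the second eigenvalue `p t 0 0 - p t 1 0` is multiplicative in `t` with
derivative `-(lam1 + lam2)` at `0`, so it equals `exp (-(lam1 + lam2) t)` as the limit of
`(1 + c / n) ^ n` (`IsTransitionSemigroup.two_state_eigenvalue`). Since `p s` and `p t` commute, the
off-diagonal entries are in the ratio `lam1 : lam2` (`IsTransitionSemigroup.two_state_ratio`).
Together with the row sums this determines the matrix; no differential equation is needed.

For the path event, the Markov property along dyadic grids and right-continuity show that a chain
which is in state `i` at time `s` stays there during `[s, s + T]` with probability `exp (A i i * T)`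
(`IsMarkovChain.measureReal_stay`).

For a right-continuous path, `economicDefault ∈ (i N, i N + t]` means exactly that the chain is
normal at the payment dates `0, …, i N` and in default throughout `[i N + t, (i + 1) N]`
(`economicDefault_mem_Ioc_iff`). The probability of this window event is a product of three factors:
the payment dates, the transition to default by time `i N + t`, and the stay in default
(`IsMarkovChain.measureReal_defaultWindow`). The windows are disjoint for different `i`, so summing a
geometric series and using continuity in `t` gives the tail of the delay
(`IsMarkovChain.measureReal_lt_delay`).
-/

/-! ### The transition matrix of the two-state chain -/

/-- A function with `g 0 = 1` and right derivative `c` at `0` satisfies `g (T / n) ^ n → exp (c T)`. -/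
lemma tendsto_pow_div_exp {g : ℝ≥0 → ℝ} {c : ℝ} (h0 : g 0 = 1)
    (hg : Tendsto (fun h : ℝ≥0 => (g h - 1) / (h : ℝ)) (𝓝[>] 0) (𝓝 c)) (T : ℝ≥0) :
    Tendsto (fun n : ℕ => g (T / n) ^ n) atTop (𝓝 (Real.exp (c * T))) := by
  rcases eq_or_ne T 0 with rfl | hT
  · simp [h0]
  have hlim : Tendsto (fun n : ℕ => T / (n : ℝ≥0)) atTop (𝓝[>] 0) := by
    refine tendsto_nhdsWithin_iff.2 ⟨?_, ?_⟩
    · exact tendsto_const_div_atTop_nhds_zero_nat T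
    · filter_upwards [eventually_gt_atTop 0] with n hn
      have : 0 < T := pos_iff_ne_zero.2 hT
      exact div_pos this (by exact_mod_cast hn)
  have key := Real.tendsto_one_add_pow_exp_of_tendsto (g := fun n : ℕ => g (T / n) - 1)
    (t := c * T) ?_
  · simpa using key
  refine Tendsto.congr' ?_ ((hg.comp hlim).mul_const (T : ℝ))
  filter_upwards [eventually_gt_atTop 0] with n hn
  have hT' : (T : ℝ) ≠ 0 := by exact_mod_cast hT
  have hn' : (n : ℝ) ≠ 0 := by exact_mod_cast hn.ne'
  simp only [Function.comp, NNReal.coe_div, NNReal.coe_natCast]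
  field_simp

lemma IsTransitionSemigroup.tendsto_pow_div_exp {E : Type*} [Fintype E] [DecidableEq E]
    {A : Matrix E E ℝ} {p : ℝ≥0 → Matrix E E ℝ} (hp : IsTransitionSemigroup A p) (i : E)
    (T : ℝ≥0) :
    Tendsto (fun n : ℕ => p (T / n) i i ^ n) atTop (𝓝 (Real.exp (A i i * T))) := by
  refine _root_.tendsto_pow_div_exp (g := fun t => p t i i) (by simp [hp.zero]) ?_ T
  simpa using hp.rate i i

/-- The second eigenvalue of the transition matrix of a two-state chain is multiplicative in time,
hence exponential. -/
lemma IsTransitionSemigroup.two_state_eigenvalue {lam1 lam2 : ℝ}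
    {p : ℝ≥0 → Matrix (Fin 2) (Fin 2) ℝ}
    (hp : IsTransitionSemigroup !![-lam1, lam1; lam2, -lam2] p) (t : ℝ≥0) :
    p t 0 0 - p t 1 0 = Real.exp (-(lam1 + lam2) * t) := by
  have hmul : ∀ s t : ℝ≥0, p (s + t) 0 0 - p (s + t) 1 0
      = (p s 0 0 - p s 1 0) * (p t 0 0 - p t 1 0) := by
    intro s t
    have h0 := hp.row_sum s 0
    have h1 := hp.row_sum s 1
    rw [Fin.sum_univ_two] at h0 h1
    simp only [hp.add, Matrix.mul_apply, Fin.sum_univ_two]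
    linear_combination p t 1 0 * (h0 - h1)
  have hpow : ∀ (n : ℕ) (h : ℝ≥0), p (n * h) 0 0 - p (n * h) 1 0
      = (p h 0 0 - p h 1 0) ^ n := by
    intro n h
    induction n with
    | zero => simp [hp.zero]
    | succ n ih => rw [Nat.cast_succ, add_mul, one_mul, hmul, ih, pow_succ]
  have hlim := _root_.tendsto_pow_div_exp (g := fun t => p t 0 0 - p t 1 0)
    (c := -(lam1 + lam2)) (by simp [hp.zero]) ?_ t
  · refine tendsto_nhds_unique (tendsto_const_nhds.congr' ?_) hlim
    filter_upwards [eventually_gt_atTop 0] with n hn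
    rw [← hpow, mul_div_cancel₀ _ (by exact_mod_cast hn.ne')]
  · have h := (hp.rate 0 0).sub (hp.rate 1 0)
    simp only [Matrix.of_apply, Matrix.cons_val', Matrix.cons_val_zero, Matrix.cons_val_one,
      Matrix.cons_val_fin_one, Matrix.one_apply_eq] at h
    convert h using 2
    · simp; ring
    · ring

/-- Commutation of `p s` with `p t`, differentiated at `s = 0`: the off-diagonal transition
probabilities are in the ratio of the rates. -/
lemma IsTransitionSemigroup.two_state_ratio {lam1 lam2 : ℝ}
    {p : ℝ≥0 → Matrix (Fin 2) (Fin 2) ℝ}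
    (hp : IsTransitionSemigroup !![-lam1, lam1; lam2, -lam2] p) (t : ℝ≥0) :
    lam1 * p t 1 0 = lam2 * p t 0 1 := by
  have hcomm : ∀ s : ℝ≥0, p s 0 1 * p t 1 0 = p s 1 0 * p t 0 1 := by
    intro s
    have h := congrFun (congrFun ((hp.add s t).symm.trans ((add_comm s t ▸ rfl :
      p (s + t) = p (t + s)).trans (hp.add t s))) 0) 0
    simp only [Matrix.mul_apply, Fin.sum_univ_two] at h
    linear_combination h
  have h01 : Tendsto (fun h : ℝ≥0 => p h 0 1 / (h : ℝ)) (𝓝[>] 0) (𝓝 lam1) := by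
    simpa using hp.rate 0 1
  have h10 : Tendsto (fun h : ℝ≥0 => p h 1 0 / (h : ℝ)) (𝓝[>] 0) (𝓝 lam2) := by
    simpa using hp.rate 1 0
  refine tendsto_nhds_unique (h01.mul_const _) ((h10.mul_const _).congr fun h => ?_)
  rw [div_mul_eq_mul_div, div_mul_eq_mul_div, hcomm]

lemma IsTransitionSemigroup.two_state_apply {lam1 lam2 : ℝ} (h12 : 0 < lam1 + lam2)
    {p : ℝ≥0 → Matrix (Fin 2) (Fin 2) ℝ}
    (hp : IsTransitionSemigroup !![-lam1, lam1; lam2, -lam2] p) (t : ℝ≥0) :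
    p t = !![lam1 / (lam1 + lam2) * Real.exp (-(lam1 + lam2) * t) + lam2 / (lam1 + lam2),
          -(lam1 / (lam1 + lam2)) * Real.exp (-(lam1 + lam2) * t) + lam1 / (lam1 + lam2);
        -(lam2 / (lam1 + lam2)) * Real.exp (-(lam1 + lam2) * t) + lam2 / (lam1 + lam2),
          lam2 / (lam1 + lam2) * Real.exp (-(lam1 + lam2) * t) + lam1 / (lam1 + lam2)] := by
  have he := hp.two_state_eigenvalue t
  have hr := hp.two_state_ratio t
  have h0 := hp.row_sum t 0
  have h1 := hp.row_sum t 1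
  rw [Fin.sum_univ_two] at h0 h1
  have h12' := h12.ne'
  rw [← he]
  ext i j
  fin_cases i <;> fin_cases j <;> simp <;> field_simp
  · linear_combination lam2 * h0 + hr
  · linear_combination lam1 * h0 - hr
  · linear_combination lam2 * h0 + hr
  · linear_combination (lam1 + lam2) * h1 - hr - lam2 * h0

/-! ### Finite-dimensional and path probabilities of a Markov chain -/

section MarkovChain

variable {Ω E : Type*}

lemma history_mono (S : ℝ≥0 → Ω → E) {s t : ℝ≥0} (h : s ≤ t) : history S s ≤ history S t :=
  biSup_mono fun _ hu => le_trans hu h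

lemma measurableSet_history (S : ℝ≥0 → Ω → E) {u s : ℝ≥0} (h : u ≤ s) (j : E) :
    MeasurableSet[history S s] {ω | S u ω = j} := by
  refine le_iSup₂ (f := fun u (_ : u ∈ Set.Iic s) => MeasurableSpace.comap (S u) ⊤) u h _ ?_
  exact ⟨{j}, trivial, rfl⟩

lemma measurableSet_history_grid (S : ℝ≥0 → Ω → E) {s : ℝ≥0} (h : ℝ≥0) (i : E) {B : Set Ω}
    (hB : MeasurableSet[history S s] B) (n : ℕ) :
    MeasurableSet[history S (s + n * h)] (B ∩ {ω | ∀ k : ℕ, k ≤ n → S (s + k * h) ω = i}) := by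
  refine MeasurableSet.inter (history_mono S le_self_add _ hB) ?_
  have : {ω | ∀ k : ℕ, k ≤ n → S (s + k * h) ω = i} = ⋂ k ∈ Set.Iic n, {ω | S (s + k * h) ω = i} := by
    ext; simp
  rw [this]
  refine MeasurableSet.biInter (Set.to_countable _) fun k hk => measurableSet_history S ?_ i
  have : (k : ℝ≥0) ≤ n := by exact_mod_cast hk
  gcongr

/-- For a right-continuous path, being in state `i` at all dyadic points of `[s, s + T]` forces the
path to stay in `i` throughout. -/
lemma forall_mem_Icc_of_dyadic {x : ℝ≥0 → E} (hx : ∀ t, ∀ᶠ u in 𝓝[>] t, x u = x t) {s T : ℝ≥0}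
    {i : E} (h : ∀ n : ℕ, ∀ k : ℕ, k ≤ 2 ^ n → x (s + k * (T / (2 ^ n : ℕ))) = i) :
    ∀ u ∈ Set.Icc s (s + T), x u = i := by
  rintro u ⟨hsu, huT⟩
  rcases huT.eq_or_lt with rfl | huT
  · simpa using h 0 1 le_rfl
  have hTpos : 0 < T := by
    by_contra hT
    have : T = 0 := by simpa using hT
    simp only [this, add_zero] at huT
    exact absurd hsu (not_le.2 huT)
  obtain ⟨b, hub, hb⟩ := (mem_nhdsGT_iff_exists_Ioo_subset' huT).1 (hx u)
  obtain ⟨n, hn⟩ : ∃ n : ℕ, T / (2 ^ n : ℕ) < min b (s + T) - u := by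
    have hlim : Tendsto (fun n : ℕ => T / ((2 ^ n : ℕ) : ℝ≥0)) atTop (𝓝 0) :=
      (tendsto_const_div_atTop_nhds_zero_nat T).comp (tendsto_pow_atTop_atTop_of_one_lt one_lt_two)
    exact (hlim.eventually_lt_const (tsub_pos_of_lt (lt_min hub huT))).exists
  set δ : ℝ≥0 := T / (2 ^ n : ℕ) with hδ
  have hδpos : 0 < δ := div_pos hTpos (by positivity)
  have hδT : ((2 ^ n : ℕ) : ℝ≥0) * δ = T := mul_div_cancel₀ _ (by positivity)
  -- The first grid point strictly after `u` lies in the interval where `x` is constant.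
  let k : ℕ := ⌊(u - s) / δ⌋₊ + 1
  have hk1 : u < s + k * δ := by
    have := Nat.lt_floor_add_one ((u - s) / δ)
    rw [div_lt_iff₀ hδpos, tsub_lt_iff_left hsu] at this
    simpa [k] using this
  have hk2 : s + k * δ ≤ u + δ := by
    have := Nat.floor_le (zero_le (a := (u - s) / δ))
    rw [le_div_iff₀ hδpos, le_tsub_iff_left hsu] at this
    simp only [k, Nat.cast_add, Nat.cast_one, add_mul, one_mul, ← add_assoc]
    gcongr
  have hk3 : s + k * δ < min b (s + T) := by
    have := lt_tsub_iff_left.1 hn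
    exact hk2.trans_lt this
  have hk4 : k ≤ 2 ^ n := by
    have h1 : s + k * δ < s + (2 ^ n : ℕ) * δ := by
      rw [hδT]; exact hk3.trans_le (min_le_right _ _)
    have h2 := lt_of_mul_lt_mul_right (lt_of_add_lt_add_left h1) hδpos.le
    exact (by exact_mod_cast h2 : k < 2 ^ n).le
  rw [← hb ⟨hk1, hk3.trans_le (min_le_left _ _)⟩]
  exact h n k hk4

variable [MeasurableSpace Ω] [Fintype E] [DecidableEq E] {μ : Measure Ω}
  {p : ℝ≥0 → Matrix E E ℝ} {S : ℝ≥0 → Ω → E}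

lemma IsMarkovChain.history_le (hS : IsMarkovChain μ p S) (s : ℝ≥0) :
    history S s ≤ ‹MeasurableSpace Ω› := by
  refine iSup₂_le fun u _ => ?_
  rintro _ ⟨t, -, rfl⟩
  have : S u ⁻¹' t = ⋃ j ∈ t, {ω | S u ω = j} := by ext; simp
  rw [this]
  exact MeasurableSet.biUnion t.to_countable fun j _ => hS.measurable u j

/-- Up to a null set, staying in state `i` during `[s, s + T]` is a condition on the dyadic points. -/
lemma IsMarkovChain.stay_ae_eq (hS : IsMarkovChain μ p S) (s T : ℝ≥0) (i : E) :
    {ω | ∀ u ∈ Set.Icc s (s + T), S u ω = i} =ᵐ[μ]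
      ⋂ n : ℕ, {ω | ∀ k : ℕ, k ≤ 2 ^ n → S (s + k * (T / (2 ^ n : ℕ))) ω = i} := by
  filter_upwards [hS.right_continuous] with ω hω
  refine propext ⟨fun h => Set.mem_iInter.2 fun n k hk => h _ ⟨le_self_add, ?_⟩, fun h => ?_⟩
  · have h1 : (k : ℝ≥0) ≤ (2 ^ n : ℕ) := by exact_mod_cast hk
    calc s + k * (T / (2 ^ n : ℕ)) ≤ s + (2 ^ n : ℕ) * (T / (2 ^ n : ℕ)) := by gcongr
      _ = s + T := by rw [mul_div_cancel₀ _ (by positivity)]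
  · exact forall_mem_Icc_of_dyadic (x := fun u => S u ω) hω (Set.mem_iInter.1 h)

lemma IsMarkovChain.nullMeasurableSet_stay (hS : IsMarkovChain μ p S) (s T : ℝ≥0) (i : E) :
    NullMeasurableSet {ω | ∀ u ∈ Set.Icc s (s + T), S u ω = i} μ := by
  refine NullMeasurableSet.congr (MeasurableSet.nullMeasurableSet ?_) (hS.stay_ae_eq s T i).symm
  refine MeasurableSet.iInter fun n => ?_
  simp only [Set.ofPred_forall]
  exact MeasurableSet.iInter fun k => MeasurableSet.iInter fun _ => hS.measurable _ i

variable [IsProbabilityMeasure μ]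

/-- The elementary Markov property: on an event of the history at which the chain is in state `i`,
the next transition contributes the factor `p h i j`. -/
lemma IsMarkovChain.measureReal_inter (hS : IsMarkovChain μ p S) {s : ℝ≥0} (h : ℝ≥0) {i : E}
    (j : E) {B : Set Ω} (hB : MeasurableSet[history S s] B) (hBi : ∀ ω ∈ B, S s ω = i) :
    μ.real (B ∩ {ω | S (s + h) ω = j}) = μ.real B * p h i j := by
  have hm := hS.history_le s
  have hj := hS.measurable (s + h) j
  have h1 := setIntegral_condExp hm (μ := μ)
    (f := Set.indicator {ω | S (s + h) ω = j} (fun _ => (1 : ℝ)))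
    ((integrable_const 1).indicator hj) hB
  rw [setIntegral_congr_ae (hm _ hB) (g := fun _ => p h i j)
    ((hS.markov s h j).mono fun ω hω hωB => by
      simp only [hω, hBi ω hωB])] at h1
  rw [setIntegral_const, setIntegral_indicator hj, setIntegral_const] at h1
  simpa using h1.symm

lemma IsMarkovChain.measureReal_grid (hS : IsMarkovChain μ p S) {s : ℝ≥0} (h : ℝ≥0) {i : E}
    {B : Set Ω} (hB : MeasurableSet[history S s] B) (hBi : ∀ ω ∈ B, S s ω = i) (n : ℕ) :
    μ.real (B ∩ {ω | ∀ k : ℕ, k ≤ n → S (s + k * h) ω = i}) = μ.real B * p h i i ^ n := by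
  induction n with
  | zero =>
    have : B ∩ {ω | ∀ k : ℕ, k ≤ 0 → S (s + k * h) ω = i} = B := by
      ext ω; simpa using hBi ω
    rw [this]; simp
  | succ n ih =>
    have : B ∩ {ω | ∀ k : ℕ, k ≤ n + 1 → S (s + k * h) ω = i}
        = (B ∩ {ω | ∀ k : ℕ, k ≤ n → S (s + k * h) ω = i}) ∩ {ω | S (s + n * h + h) ω = i} := by
      ext ω
      have : s + ((n + 1 : ℕ) : ℝ≥0) * h = s + n * h + h := by push_cast; ring
      simp only [Set.mem_inter_iff, Set.mem_ofPred_eq, Nat.le_succ_iff, or_imp, forall_and,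
        forall_eq, this, and_assoc]
    rw [this, hS.measureReal_inter h i (measurableSet_history_grid S h i hB n)
      (fun ω hω => hω.2 n le_rfl), ih, pow_succ, mul_assoc]

/-- The holding time in a state is exponential: on an event of the history at time `s` at which the
chain is in state `i`, it stays in `i` during `[s, s + T]` with conditional probability
`exp (A i i * T)`. -/
lemma IsMarkovChain.measureReal_stay {A : Matrix E E ℝ} (hS : IsMarkovChain μ p S)
    (hp : IsTransitionSemigroup A p) {s : ℝ≥0} (T : ℝ≥0) {i : E} {B : Set Ω}
    (hB : MeasurableSet[history S s] B) (hBi : ∀ ω ∈ B, S s ω = i) :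
    μ.real (B ∩ {ω | ∀ u ∈ Set.Icc s (s + T), S u ω = i})
      = μ.real B * Real.exp (A i i * T) := by
  set G : ℕ → Set Ω := fun n => B ∩ {ω | ∀ k : ℕ, k ≤ 2 ^ n → S (s + k * (T / (2 ^ n : ℕ))) ω = i}
    with hG
  have hGm : ∀ n, MeasurableSet (G n) := fun n =>
    hS.history_le _ _ (measurableSet_history_grid S _ i hB (2 ^ n))
  have hanti : Antitone G := by
    refine antitone_nat_of_succ_le fun n ω hω => ⟨hω.1, fun k hk => ?_⟩
    have h := hω.2 (2 * k) (by rw [pow_succ]; omega)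
    have h2 : ((2 * k : ℕ) : ℝ≥0) * (T / (2 ^ (n + 1) : ℕ)) = k * (T / (2 ^ n : ℕ)) := by
      push_cast; rw [pow_succ]; field_simp
    rwa [h2] at h
  have hae : (B ∩ {ω | ∀ u ∈ Set.Icc s (s + T), S u ω = i} : Set Ω) =ᵐ[μ] ⋂ n, G n := by
    rw [hG, ← Set.inter_iInter]
    exact (ae_eq_refl B).inter (hS.stay_ae_eq s T i)
  rw [measureReal_congr hae]
  have h1 : Tendsto (fun n => μ.real (G n)) atTop (𝓝 (μ.real (⋂ n, G n))) :=
    (ENNReal.tendsto_toReal (measure_ne_top _ _)).comp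
      (tendsto_measure_iInter_atTop (fun n => (hGm n).nullMeasurableSet) hanti
        ⟨0, measure_ne_top _ _⟩)
  refine tendsto_nhds_unique h1 ?_
  simp only [hG, hS.measureReal_grid _ hB hBi]
  exact ((hp.tendsto_pow_div_exp i T).comp
    (tendsto_pow_atTop_atTop_of_one_lt one_lt_two)).const_mul _

end MarkovChain

/-! ### Path description of the two default times -/

section Path

variable {Ω E : Type*} {S : ℝ≥0 → Ω → E} {d : E} {N : ℝ≥0} {ω : Ω}

lemma recordedDefault_le {k : ℕ} (hk : S (k * N) ω = d) :
    recordedDefault S d N ω ≤ ((k * N : ℝ≥0) : ℝ≥0∞) :=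
  sInf_le ⟨k, rfl, hk⟩

lemma le_recordedDefault {k : ℕ} (h : ∀ j : ℕ, j < k → S (j * N) ω ≠ d) :
    ((k * N : ℝ≥0) : ℝ≥0∞) ≤ recordedDefault S d N ω := by
  refine le_sInf ?_
  rintro _ ⟨j, rfl, hj⟩
  have hkj : (k : ℝ≥0) ≤ j := by exact_mod_cast le_of_not_gt fun hlt => h j hlt hj
  exact ENNReal.coe_le_coe.2 (by gcongr)

lemma recordedDefault_eq {k : ℕ} (hk : S (k * N) ω = d)
    (h : ∀ j : ℕ, j < k → S (j * N) ω ≠ d) :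
    recordedDefault S d N ω = ((k * N : ℝ≥0) : ℝ≥0∞) :=
  (recordedDefault_le hk).antisymm (le_recordedDefault h)

lemma recordedDefault_eq_top (h : ∀ j : ℕ, S (j * N) ω ≠ d) : recordedDefault S d N ω = ∞ := by
  refine sInf_eq_top.2 ?_
  rintro _ ⟨j, rfl, hj⟩
  exact absurd hj (h j)

lemma recordedDefault_eq_iff (hN : 0 < N) (k : ℕ) :
    recordedDefault S d N ω = ((k * N : ℝ≥0) : ℝ≥0∞) ↔
      (∀ j : ℕ, j < k → S (j * N) ω ≠ d) ∧ S (k * N) ω = d := by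
  classical
  refine ⟨fun h => ?_, fun h => recordedDefault_eq h.2 h.1⟩
  by_cases hex : ∃ j : ℕ, S (j * N) ω = d
  · have h1 := recordedDefault_eq (Nat.find_spec hex) fun j hj => Nat.find_min hex hj
    rw [h, ENNReal.coe_inj, mul_left_inj' hN.ne', Nat.cast_inj] at h1
    exact ⟨fun j hj => Nat.find_min hex (h1 ▸ hj), h1 ▸ Nat.find_spec hex⟩
  · rw [recordedDefault_eq_top (not_exists.1 hex)] at h
    exact absurd h ENNReal.top_ne_coe

lemma economicDefault_le_recordedDefault :
    economicDefault S d N ω ≤ recordedDefault S d N ω := by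
  refine sSup_le ?_
  rintro _ ⟨t, rfl, h, -⟩
  exact h

lemma le_economicDefault {u : ℝ≥0} (hu : (u : ℝ≥0∞) ≤ recordedDefault S d N ω)
    (h : S u ω ≠ d) : (u : ℝ≥0∞) ≤ economicDefault S d N ω :=
  le_sSup ⟨u, rfl, hu, h⟩

lemma lt_economicDefault {u : ℝ≥0} (hrc : ∀ᶠ v in 𝓝[>] u, S v ω = S u ω)
    (hu : (u : ℝ≥0∞) < recordedDefault S d N ω) (h : S u ω ≠ d) :
    (u : ℝ≥0∞) < economicDefault S d N ω := by
  obtain ⟨w, huw, hw⟩ := ENNReal.lt_iff_exists_nnreal_btwn.1 hu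
  obtain ⟨v, hv, hv1⟩ := (hrc.and (Ioc_mem_nhdsGT (ENNReal.coe_lt_coe.1 huw))).exists
  refine (ENNReal.coe_lt_coe.2 hv1.1).trans_le (le_economicDefault ?_ (hv ▸ h))
  exact (ENNReal.coe_le_coe.2 hv1.2).trans hw.le

/-- The event that the chain is outside the default state `d` at the payment dates `0, …, i * N` and
that it is in `d` during the whole of `[i * N + t, (i + 1) * N]`. -/
def defaultWindow (S : ℝ≥0 → Ω → E) (d : E) (N : ℝ≥0) (i : ℕ) (t : ℝ≥0) : Set Ω :=
  {ω | ∀ j : ℕ, j ≤ i → S (j * N) ω ≠ d} ∩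
    {ω | ∀ u ∈ Set.Icc (i * N + t) ((i + 1 : ℕ) * N), S u ω = d}

lemma add_le_succ_mul {t : ℝ≥0} (ht : t ≤ N) (i : ℕ) : i * N + t ≤ ((i + 1 : ℕ) : ℝ≥0) * N := by
  rw [Nat.cast_succ, add_mul, one_mul]
  gcongr

lemma recordedDefault_of_mem_defaultWindow {i : ℕ} {t : ℝ≥0} (ht : t ≤ N)
    (h : ω ∈ defaultWindow S d N i t) :
    recordedDefault S d N ω = (((i + 1 : ℕ) * N : ℝ≥0) : ℝ≥0∞) :=
  recordedDefault_eq (h.2 _ ⟨add_le_succ_mul ht i, le_rfl⟩)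
    fun j hj => h.1 j (Nat.lt_succ_iff.1 hj)

/-- For a right-continuous path, the economic default time lies in `(i * N, i * N + t]` exactly on
the window event. -/
lemma economicDefault_mem_Ioc_iff (hN : 0 < N) (hrc : ∀ t, ∀ᶠ u in 𝓝[>] t, S u ω = S t ω)
    {t : ℝ≥0} (ht : t ≤ N) (i : ℕ) :
    economicDefault S d N ω ∈
        Set.Ioc ((i * N : ℝ≥0) : ℝ≥0∞) ((i * N + t : ℝ≥0) : ℝ≥0∞) ↔
      ω ∈ defaultWindow S d N i t := by
  have hlt : ∀ k : ℕ, (k : ℝ≥0) * N < ((k + 1 : ℕ) : ℝ≥0) * N := fun k =>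
    mul_lt_mul_of_pos_right (by exact_mod_cast Nat.lt_succ_self k) hN
  have hle := add_le_succ_mul ht i
  refine ⟨fun ⟨hl, hu⟩ => ?_, fun h => ?_⟩
  · have hbefore : ∀ j : ℕ, j ≤ i → S (j * N) ω ≠ d := by
      intro j hj hjd
      have hji : (j : ℝ≥0) ≤ i := by exact_mod_cast hj
      refine absurd (hl.trans_le (economicDefault_le_recordedDefault.trans
        (recordedDefault_le hjd))) (not_lt.2 (ENNReal.coe_le_coe.2 ?_))
      gcongr
    -- Otherwise the path would be outside `d` at, hence also just after, the next payment date.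
    have hat : S ((i + 1 : ℕ) * N) ω = d := by
      by_contra hne
      have hr : (((i + 1 + 1 : ℕ) * N : ℝ≥0) : ℝ≥0∞) ≤ recordedDefault S d N ω :=
        le_recordedDefault fun j hj => by
          rcases (Nat.lt_succ_iff.1 hj).eq_or_lt with rfl | hj'
          · exact hne
          · exact hbefore j (Nat.lt_succ_iff.1 hj')
      have := lt_economicDefault (hrc _)
        ((ENNReal.coe_lt_coe.2 (hlt (i + 1))).trans_le hr) hne
      exact absurd (this.trans_le hu) (not_lt.2 (ENNReal.coe_le_coe.2 hle))
    have hr := recordedDefault_eq hat fun j hj => hbefore j (Nat.lt_succ_iff.1 hj)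
    refine ⟨hbefore, fun u hu' => ?_⟩
    rcases hu'.2.eq_or_lt with rfl | hlt'
    · exact hat
    · by_contra hne
      have := lt_economicDefault (hrc u) (hr ▸ ENNReal.coe_lt_coe.2 hlt') hne
      exact absurd (this.trans_le hu) (not_lt.2 (ENNReal.coe_le_coe.2 hu'.1))
  · have hr := recordedDefault_of_mem_defaultWindow ht h
    refine ⟨lt_economicDefault (hrc _) (hr ▸ ENNReal.coe_lt_coe.2 (hlt i)) (h.1 i le_rfl), ?_⟩
    refine sSup_le ?_
    rintro _ ⟨u, rfl, hu, hud⟩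
    rw [hr, ENNReal.coe_le_coe] at hu
    by_contra hgt
    exact hud (h.2 u ⟨(ENNReal.coe_lt_coe.1 (not_le.1 hgt)).le, hu⟩)

/-- If the delay exceeds `t`, then the economic default happened at least `t` before the end of its
payment period. -/
lemma exists_mem_defaultWindow_of_lt_delay (hN : 0 < N)
    (hrc : ∀ t, ∀ᶠ u in 𝓝[>] t, S u ω = S t ω) (h0 : S 0 ω ≠ d) {t : ℝ≥0} (ht : t ≤ N)
    (h : (t : ℝ≥0∞) < recordedDefault S d N ω - economicDefault S d N ω) :
    ∃ i : ℕ, ω ∈ defaultWindow S d N i (N - t) := by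
  classical
  by_cases hex : ∃ j : ℕ, S (j * N) ω = d
  · obtain ⟨i, hi⟩ : ∃ i, Nat.find hex = i + 1 := by
      refine Nat.exists_eq_succ_of_ne_zero fun hz => h0 ?_
      simpa [hz] using Nat.find_spec hex
    have hat : S ((i + 1 : ℕ) * N) ω = d := hi ▸ Nat.find_spec hex
    have hbefore : ∀ j : ℕ, j < i + 1 → S (j * N) ω ≠ d := fun j hj =>
      Nat.find_min hex (hi ▸ hj)
    have hr := recordedDefault_eq hat hbefore
    refine ⟨i, (economicDefault_mem_Ioc_iff hN hrc tsub_le_self i).1 ⟨?_, ?_⟩⟩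
    · refine lt_economicDefault (hrc _) (hr ▸ ENNReal.coe_lt_coe.2 ?_) (hbefore i i.lt_succ_self)
      exact mul_lt_mul_of_pos_right (by exact_mod_cast Nat.lt_succ_self i) hN
    · rw [hr, lt_tsub_iff_left] at h
      have he : (((i + 1 : ℕ) * N : ℝ≥0) : ℝ≥0∞) = ((i * N + (N - t) : ℝ≥0) : ℝ≥0∞) + t := by
        rw [← ENNReal.coe_add, add_assoc, tsub_add_cancel_of_le ht, Nat.cast_succ, add_mul, one_mul]
      rw [he] at h
      exact (lt_of_add_lt_add_right h).le
  · have hne := not_exists.1 hex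
    have htop : economicDefault S d N ω = ∞ := by
      refine ENNReal.eq_top_of_forall_nnreal_le fun r => ?_
      obtain ⟨k, hk⟩ := exists_nat_ge (r / N)
      have hk' : r ≤ k * N := (div_le_iff₀ hN).1 hk
      refine (ENNReal.coe_le_coe.2 hk').trans (le_economicDefault ?_ (hne k))
      rw [recordedDefault_eq_top hne]
      exact le_top
    simp [htop] at h

lemma lt_delay_of_mem_defaultWindow (hN : 0 < N)
    (hrc : ∀ t, ∀ᶠ u in 𝓝[>] t, S u ω = S t ω) {t t' : ℝ≥0} (htt : t < t') (ht' : t' ≤ N) {i : ℕ}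
    (h : ω ∈ defaultWindow S d N i (N - t')) :
    (t : ℝ≥0∞) < recordedDefault S d N ω - economicDefault S d N ω := by
  have hu := ((economicDefault_mem_Ioc_iff hN hrc tsub_le_self i).2 h).2
  rw [recordedDefault_of_mem_defaultWindow tsub_le_self h, lt_tsub_iff_left]
  refine (add_le_add_left hu _).trans_lt ?_
  rw [← ENNReal.coe_add, ENNReal.coe_lt_coe, Nat.cast_succ, add_mul, one_mul, add_assoc]
  gcongr
  exact (add_lt_add_of_le_of_lt le_rfl htt).trans_eq (tsub_add_cancel_of_le ht')

lemma pairwise_disjoint_defaultWindow {t : ℝ≥0} (ht : t ≤ N) (hN : 0 < N) :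
    Pairwise (Function.onFun Disjoint fun i => defaultWindow S d N i t) := by
  intro i j hij
  refine Set.disjoint_left.2 fun ω hi hj => hij ?_
  have h := (recordedDefault_of_mem_defaultWindow ht hi).symm.trans
    (recordedDefault_of_mem_defaultWindow ht hj)
  rw [ENNReal.coe_inj, mul_left_inj' hN.ne', Nat.cast_inj] at h
  exact Nat.succ_injective h

end Path

/-! ### Laws of the default times -/

section Law

variable {Ω : Type*}

/-- The event that the chain is in the state `0` at the payment dates `0, …, i * N`. -/
def normalUpTo (S : ℝ≥0 → Ω → Fin 2) (N : ℝ≥0) (i : ℕ) : Set Ω :=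
  {ω | ∀ j : ℕ, j ≤ i → S (j * N) ω = 0}

lemma normalUpTo_eq (S : ℝ≥0 → Ω → Fin 2) (N : ℝ≥0) (i : ℕ) :
    normalUpTo S N i = {ω | S 0 ω = 0} ∩ {ω | ∀ k : ℕ, k ≤ i → S (0 + k * N) ω = 0} := by
  ext ω
  simp only [normalUpTo, zero_add, Set.mem_inter_iff, Set.mem_ofPred_eq]
  exact ⟨fun h => ⟨by simpa using h 0 (Nat.zero_le _), h⟩, fun h => h.2⟩

lemma measurableSet_normalUpTo (S : ℝ≥0 → Ω → Fin 2) (N : ℝ≥0) (i : ℕ) :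
    MeasurableSet[history S (i * N)] (normalUpTo S N i) := by
  have h := measurableSet_history_grid S N 0 (measurableSet_history S (le_refl 0) 0) i
  rwa [← normalUpTo_eq, zero_add] at h

lemma defaultWindow_eq (S : ℝ≥0 → Ω → Fin 2) {N t : ℝ≥0} (ht : t ≤ N) (i : ℕ) :
    defaultWindow S 1 N i t = (normalUpTo S N i ∩ {ω | S (i * N + t) ω = 1}) ∩
      {ω | ∀ u ∈ Set.Icc (i * N + t) (i * N + t + (N - t)), S u ω = 1} := by
  have hend : i * N + t + (N - t) = ((i + 1 : ℕ) : ℝ≥0) * N := by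
    rw [add_assoc, add_tsub_cancel_of_le ht, Nat.cast_succ, add_mul, one_mul]
  have hne : ∀ x : Fin 2, x ≠ 1 ↔ x = 0 := by decide
  ext ω
  simp only [defaultWindow, normalUpTo, hend, Set.mem_inter_iff, Set.mem_ofPred_eq, hne]
  exact ⟨fun h => ⟨⟨h.1, h.2 _ ⟨le_rfl, add_le_succ_mul ht i⟩⟩, h.2⟩, fun h => ⟨h.1.1, h.2⟩⟩

variable [MeasurableSpace Ω] {μ : Measure Ω} {p : ℝ≥0 → Matrix (Fin 2) (Fin 2) ℝ}
  {S : ℝ≥0 → Ω → Fin 2}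

lemma IsMarkovChain.nullMeasurableSet_defaultWindow (hS : IsMarkovChain μ p S) {N t : ℝ≥0}
    (ht : t ≤ N) (i : ℕ) : NullMeasurableSet (defaultWindow S 1 N i t) μ := by
  rw [defaultWindow_eq S ht]
  exact (((hS.history_le _ _ (measurableSet_normalUpTo S N i)).inter
    (hS.measurable _ _)).nullMeasurableSet).inter (hS.nullMeasurableSet_stay _ _ _)

variable [IsProbabilityMeasure μ]

lemma IsMarkovChain.measureReal_normalUpTo (hS : IsMarkovChain μ p S)
    (hS0 : ∀ᵐ ω ∂μ, S 0 ω = 0) (N : ℝ≥0) (i : ℕ) :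
    μ.real (normalUpTo S N i) = p N 0 0 ^ i := by
  rw [normalUpTo_eq, hS.measureReal_grid N (measurableSet_history S (le_refl 0) 0)
    (fun _ h => h) i]
  have : μ.real {ω | S 0 ω = 0} = 1 := by
    rw [measureReal_congr (t := Set.univ) (eventuallyEq_univ.2 hS0)]
    simp
  rw [this, one_mul]

lemma IsMarkovChain.measureReal_normalUpTo_inter (hS : IsMarkovChain μ p S)
    (hS0 : ∀ᵐ ω ∂μ, S 0 ω = 0) (N t : ℝ≥0) (i : ℕ) :
    μ.real (normalUpTo S N i ∩ {ω | S (i * N + t) ω = 1}) = p N 0 0 ^ i * p t 0 1 := by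
  rw [hS.measureReal_inter t 1 (measurableSet_normalUpTo S N i) (fun ω h => h i le_rfl),
    hS.measureReal_normalUpTo hS0]

lemma IsMarkovChain.measureReal_defaultWindow {A : Matrix (Fin 2) (Fin 2) ℝ}
    (hS : IsMarkovChain μ p S) (hp : IsTransitionSemigroup A p) (hS0 : ∀ᵐ ω ∂μ, S 0 ω = 0)
    {N t : ℝ≥0} (ht : t ≤ N) (i : ℕ) :
    μ.real (defaultWindow S 1 N i t)
      = p N 0 0 ^ i * p t 0 1 * Real.exp (A 1 1 * ((N : ℝ) - t)) := by
  rw [defaultWindow_eq S ht, hS.measureReal_stay hp (N - t) ?_ (fun ω h => h.2),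
    hS.measureReal_normalUpTo_inter hS0, NNReal.coe_sub ht]
  exact (history_mono S le_self_add _ (measurableSet_normalUpTo S N i)).inter
    (measurableSet_history S le_rfl 1)

/-- Summing the window probabilities over all payment periods gives a geometric series. -/
lemma IsMarkovChain.measureReal_iUnion_defaultWindow {A : Matrix (Fin 2) (Fin 2) ℝ}
    (hS : IsMarkovChain μ p S) (hp : IsTransitionSemigroup A p) (hS0 : ∀ᵐ ω ∂μ, S 0 ω = 0)
    {N t : ℝ≥0} (hN : 0 < N) (ht : t ≤ N) (hlt : p N 0 0 < 1) :
    μ.real (⋃ i, defaultWindow S 1 N i t)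
      = (1 - p N 0 0)⁻¹ * (p t 0 1 * Real.exp (A 1 1 * ((N : ℝ) - t))) := by
  rw [measureReal_def, measure_iUnion₀
    (fun i j hij => (pairwise_disjoint_defaultWindow ht hN hij).aedisjoint)
    (fun i => hS.nullMeasurableSet_defaultWindow ht i),
    ENNReal.tsum_toReal_eq fun i => measure_ne_top _ _]
  simp only [← measureReal_def, hS.measureReal_defaultWindow hp hS0 ht, mul_assoc]
  rw [tsum_mul_right, tsum_geometric_of_lt_one (hp.nonneg N 0 0) hlt]

/-- The tail of the delay between the economic and the recorded default. The event lies between the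
unions of the windows `N - t'` for `t' > t` and the union of the windows `N - t`, so its
probability follows by continuity. -/
lemma IsMarkovChain.measureReal_lt_delay {A : Matrix (Fin 2) (Fin 2) ℝ}
    (hS : IsMarkovChain μ p S) (hp : IsTransitionSemigroup A p) (hS0 : ∀ᵐ ω ∂μ, S 0 ω = 0)
    {N t : ℝ≥0} (hN : 0 < N) (ht : t ≤ N) (hlt : p N 0 0 < 1)
    (hc : Continuous fun t => p t 0 1) :
    μ.real {ω | (t : ℝ≥0∞) < recordedDefault S 1 N ω - economicDefault S 1 N ω}
      = (1 - p N 0 0)⁻¹ * (p (N - t) 0 1 * Real.exp (A 1 1 * t)) := by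
  have hform : ∀ r : ℝ≥0, r ≤ N → μ.real (⋃ i, defaultWindow S 1 N i (N - r))
      = (1 - p N 0 0)⁻¹ * (p (N - r) 0 1 * Real.exp (A 1 1 * r)) := by
    intro r hr
    rw [hS.measureReal_iUnion_defaultWindow hp hS0 hN tsub_le_self hlt, NNReal.coe_sub hr,
      sub_sub_cancel]
  refine le_antisymm ?_ ?_
  · rw [← hform t ht]
    refine ENNReal.toReal_mono (measure_ne_top _ _) (measure_mono_ae ?_)
    filter_upwards [hS.right_continuous, hS0] with ω hrc h0 h
    exact Set.mem_iUnion.2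
      (exists_mem_defaultWindow_of_lt_delay hN hrc (by rw [h0]; decide) ht h)
  · rcases ht.eq_or_lt with rfl | htN
    · simp [hp.zero]
    have hcont : Continuous fun r : ℝ≥0 =>
        (1 - p N 0 0)⁻¹ * (p (N - r) 0 1 * Real.exp (A 1 1 * r)) := by
      have : Continuous fun r : ℝ≥0 => p (N - r) 0 1 := hc.comp (continuous_const.sub continuous_id)
      fun_prop
    refine le_of_tendsto ((hcont.tendsto t).mono_left (nhdsWithin_le_nhds (s := Set.Ioi t))) ?_
    filter_upwards [Ioc_mem_nhdsGT htN] with r hr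
    rw [← hform r hr.2]
    refine ENNReal.toReal_mono (measure_ne_top _ _) (measure_mono_ae ?_)
    filter_upwards [hS.right_continuous] with ω hrc h
    obtain ⟨i, hi⟩ := Set.mem_iUnion.1 h
    exact lt_delay_of_mem_defaultWindow hN hrc hr.1 hr.2 hi

end Law

theorem mainTheorem4 {Ω : Type*} [MeasurableSpace Ω] (μ : Measure Ω) [IsProbabilityMeasure μ]
    (lam1 lam2 : ℝ) (h1 : 0 ≤ lam1) (h2 : 0 ≤ lam2) (h12 : 0 < lam1 + lam2)
    (p : ℝ≥0 → Matrix (Fin 2) (Fin 2) ℝ)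
    (hp : IsTransitionSemigroup !![-lam1, lam1; lam2, -lam2] p)
    (S : ℝ≥0 → Ω → Fin 2) (hS : IsMarkovChain μ p S) (hS0 : ∀ᵐ ω ∂μ, S 0 ω = 0)
    (N : ℝ≥0) (hN : 0 < N) :
    (∀ s t : ℝ≥0, s ≤ t → p (t - s) =
      !![lam1 / (lam1 + lam2) * Real.exp (-(lam1 + lam2) * ((t : ℝ) - s)) + lam2 / (lam1 + lam2),
          -(lam1 / (lam1 + lam2)) * Real.exp (-(lam1 + lam2) * ((t : ℝ) - s))
            + lam1 / (lam1 + lam2);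
        -(lam2 / (lam1 + lam2)) * Real.exp (-(lam1 + lam2) * ((t : ℝ) - s))
            + lam2 / (lam1 + lam2),
          lam2 / (lam1 + lam2) * Real.exp (-(lam1 + lam2) * ((t : ℝ) - s))
            + lam1 / (lam1 + lam2)]) ∧
    (∀ (i : ℕ) (t : ℝ≥0), t ≤ N →
      μ.real {ω | economicDefault S 1 N ω ∈
          Set.Ioc ((i * N : ℝ≥0) : ℝ≥0∞) ((i * N + t : ℝ≥0) : ℝ≥0∞)} =
        (lam1 / (lam1 + lam2) * Real.exp (-(lam1 + lam2) * N) + lam2 / (lam1 + lam2)) ^ i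
          * (lam1 / (lam1 + lam2) - lam1 / (lam1 + lam2) * Real.exp (-(lam1 + lam2) * t))
          * Real.exp (-lam2 * ((N : ℝ) - t))) ∧
    (∀ i : ℕ,
      μ.real {ω | recordedDefault S 1 N ω = (((i + 1 : ℕ) * N : ℝ≥0) : ℝ≥0∞)} =
        (lam1 / (lam1 + lam2) * Real.exp (-(lam1 + lam2) * N) + lam2 / (lam1 + lam2)) ^ i
          * (-(lam1 / (lam1 + lam2)) * Real.exp (-(lam1 + lam2) * N)
            + lam1 / (lam1 + lam2))) ∧
    (0 < lam1 → ∀ t : ℝ≥0, t ≤ N →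
      μ.real {ω | (t : ℝ≥0∞) < recordedDefault S 1 N ω - economicDefault S 1 N ω} =
        (Real.exp (-lam2 * t) - Real.exp (-(lam1 + lam2) * N) * Real.exp (lam1 * t))
          / (1 - Real.exp (-(lam1 + lam2) * N))) := by
  have hP := hp.two_state_apply h12
  have hq : p N 0 0
      = lam1 / (lam1 + lam2) * Real.exp (-(lam1 + lam2) * N) + lam2 / (lam1 + lam2) := by
    rw [hP N]; rfl
  have h01 : ∀ t : ℝ≥0, p t 0 1
      = -(lam1 / (lam1 + lam2)) * Real.exp (-(lam1 + lam2) * t) + lam1 / (lam1 + lam2) := by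
    intro t; rw [hP t]; rfl
  refine ⟨fun s t hst => ?_, fun i t ht => ?_, fun i => ?_, fun hpos t ht => ?_⟩
  · rw [hP (t - s), NNReal.coe_sub hst]
  · rw [measureReal_congr (t := defaultWindow S 1 N i t), hS.measureReal_defaultWindow hp hS0 ht,
      hq, h01]
    · simp only [Matrix.of_apply, Matrix.cons_val', Matrix.cons_val_one,
        Matrix.cons_val_fin_one]
      ring
    · filter_upwards [hS.right_continuous] with ω hrc
      exact propext (economicDefault_mem_Ioc_iff hN hrc ht i)
  · have hev : {ω | recordedDefault S 1 N ω = (((i + 1 : ℕ) * N : ℝ≥0) : ℝ≥0∞)}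
        = normalUpTo S N i ∩ {ω | S (i * N + N) ω = 1} := by
      have hne : ∀ x : Fin 2, x ≠ 1 ↔ x = 0 := by decide
      ext ω
      rw [Set.mem_ofPred_eq, recordedDefault_eq_iff hN]
      simp only [normalUpTo, Set.mem_inter_iff, Set.mem_ofPred_eq, hne, Nat.lt_succ_iff,
        Nat.cast_succ, add_mul, one_mul]
    rw [hev, hS.measureReal_normalUpTo_inter hS0, hq, h01]
  · have hNR : (0 : ℝ) < N := by exact_mod_cast hN
    have hexp : Real.exp (-(lam1 + lam2) * N) < 1 :=
      Real.exp_zero ▸ Real.exp_lt_exp.2 (by nlinarith [mul_pos h12 hNR])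
    have h1q : 1 - p N 0 0 = lam1 / (lam1 + lam2) * (1 - Real.exp (-(lam1 + lam2) * N)) := by
      rw [hq]; field_simp; ring
    have hlt : p N 0 0 < 1 := by
      have : 0 < 1 - p N 0 0 := h1q ▸ mul_pos (div_pos hpos h12) (sub_pos.2 hexp)
      linarith
    have hc : Continuous fun t => p t 0 1 := by
      simp only [h01]
      fun_prop
    rw [hS.measureReal_lt_delay hp hS0 hN ht hlt hc, h1q, h01, NNReal.coe_sub ht]
    have hprod : Real.exp (-(lam1 + lam2) * ((N : ℝ) - t)) * Real.exp (-lam2 * t)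
        = Real.exp (-(lam1 + lam2) * N) * Real.exp (lam1 * t) := by
      rw [← Real.exp_add, ← Real.exp_add]; congr 1; ring
    have hd : 1 - Real.exp (-(lam1 + lam2) * N) ≠ 0 := (sub_pos.2 hexp).ne'
    have hl := hpos.ne'
    have hll := h12.ne'
    simp only [Matrix.of_apply, Matrix.cons_val', Matrix.cons_val_one,
      Matrix.cons_val_fin_one]
    rw [← hprod, eq_div_iff hd]
    generalize 1 - Real.exp (-(lam1 + lam2) * N) = D at *
    field_simp
    ring
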